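/- All differential graded algebras (DGAs) are graded commutative, over $\mathbb{Q}$, graded by $\mathbb{N}$, with differential of degree $+1$. If $S \subseteq T$ are sub-DGAs, $T$ is a \emph{Hirsch extension} of $S$ of degree $n$ if there is a vector space $V$ of elements of degree $n$ with $dV \subseteq S$ such that multiplication $S \otimes_{\mathbb{Q}} \Lambda(V) \to T$ is bijective, where $\Lambda(V)$ is the free graded commutative algebra on $V$ placed in degree $n$. A \emph{minimal algebra} is a DGA $m$ that is an increasing union of sub-DGAs $m_0 \subseteq m_1 \subseteq m_2 \subseteq \cdots$ with $m_0 = m_1 = \mathbb{Q}$, such that $m_{k+1}$ is a Hirsch extension of $m_k$ of degree $k+1$ for every $k \ge 0$ (so $m$ is free as a graded commutative algebra); then $m_k$ is the sub-DGA of $m$ generated by the elements of degree $\le k$. A morphism of DGAs is an \emph{$n$-isomorphism} if it induces an isomorphism on $H^i$ for every $i \le n$ and a monomorphism on $H^{n+1}$. \textbf{Proposition.} Let $m, m'$ be minimal algebras and let $k \ge 0$ be such that $m_k \cong m'_k$ as DGAs. If there is a morphism of DGAs $m_{k+1} \to m'_{k+1}$ which is a $(k+1)$-isomorphism, then $m_{k+1}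 \cong m'_{k+1}$ as DGAs. -/

import Mathlib

open scoped DirectSum TensorProduct

universe u v

noncomputable section

/-- A commutative differential graded algebra over `ℚ`, graded by the natural numbers, with a
differential of degree `+1`. The underlying algebra is `carrier`, and `gr n` is its degree `n`
part. -/
structure CDGA where
  carrier : Type u
  [ring : Ring carrier]
  [algebra : Algebra ℚ carrier]
  gr : ℕ → Submodule ℚ carrier
  [graded : GradedAlgebra gr]
  d : carrier →ₗ[ℚ] carrier
  d_mem : ∀ {n : ℕ} {x : carrier}, x ∈ gr n → d x ∈ gr (n + 1)
  d_d : ∀ x : carrier, d (d x) = 0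
  leibniz : ∀ {i : ℕ} {x : carrier} (y : carrier), x ∈ gr i →
    d (x * y) = d x * y + (-1 : ℚ) ^ i • (x * d y)
  graded_comm : ∀ {i j : ℕ} {x y : carrier}, x ∈ gr i → y ∈ gr j →
    x * y = (-1 : ℚ) ^ (i * j) • (y * x)

namespace CDGA

instance : CoeSort CDGA.{u} (Type u) := ⟨CDGA.carrier⟩

attribute [instance] CDGA.ring CDGA.algebra CDGA.graded

/-! ### Morphisms and isomorphisms -/

/-- A morphism of CDGAs: an algebra map preserving degrees and commuting with `d`. -/
structure Hom (A : CDGA.{u}) (B : CDGA.{v}) where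
  toAlgHom : A →ₐ[ℚ] B
  map_gr : ∀ {n : ℕ} {x : A}, x ∈ A.gr n → toAlgHom x ∈ B.gr n
  map_d : ∀ x : A, toAlgHom (A.d x) = B.d (toAlgHom x)

/-- Two CDGAs are isomorphic if there are mutually inverse morphisms between them. -/
def Isomorphic (A : CDGA.{u}) (B : CDGA.{v}) : Prop :=
  ∃ (f : Hom A B) (g : Hom B A),
    (∀ x, g.toAlgHom (f.toAlgHom x) = x) ∧ (∀ y, f.toAlgHom (g.toAlgHom y) = y)

/-! ### Cohomology -/

/-- The cocycles of degree `n`. -/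
def cocycles (A : CDGA.{u}) (n : ℕ) : Submodule ℚ A := A.gr n ⊓ LinearMap.ker A.d

/-- The coboundaries of degree `n`, inside the cocycles. Since `d` is homogeneous of degree `1`, an
element of degree `n` in the image of `d` is the differential of an element of degree `n - 1`
(and is zero if `n = 0`). -/
def coboundaries (A : CDGA.{u}) (n : ℕ) : Submodule ℚ (A.cocycles n) :=
  (LinearMap.range A.d).comap (A.cocycles n).subtype

/-- The cohomology in degree `n`. -/
abbrev cohomology (A : CDGA.{u}) (n : ℕ) : Type u := A.cocycles n ⧸ A.coboundaries n

/-- The map induced by a morphism on cocycles. -/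
def Hom.cocyclesMap {A : CDGA.{u}} {B : CDGA.{v}} (f : Hom A B) (n : ℕ) :
    A.cocycles n →ₗ[ℚ] B.cocycles n :=
  f.toAlgHom.toLinearMap.restrict (by
    rintro x ⟨hx, hdx⟩
    refine ⟨f.map_gr hx, ?_⟩
    have h : A.d x = 0 := hdx
    change B.d (f.toAlgHom x) = 0
    rw [← f.map_d, h, map_zero])

/-- The map induced by a morphism on cohomology. -/
def Hom.cohomologyMap {A : CDGA.{u}} {B : CDGA.{v}} (f : Hom A B) (n : ℕ) :
    A.cohomology n →ₗ[ℚ] B.cohomology n :=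
  Submodule.mapQ _ _ (f.cocyclesMap n) (by
    rintro x ⟨y, hy⟩
    exact ⟨f.toAlgHom y, by rw [← f.map_d, hy]; rfl⟩)

/-- An `n`-isomorphism: an isomorphism on cohomology in degrees `≤ n` and a monomorphism on
cohomology in degree `n + 1`. -/
def Hom.IsNIsomorphism {A : CDGA.{u}} {B : CDGA.{v}} (f : Hom A B) (n : ℕ) : Prop :=
  (∀ i ≤ n, Function.Bijective (f.cohomologyMap i)) ∧
    Function.Injective (f.cohomologyMap (n + 1))

/-! ### Sub-DGAs -/

/-- A sub-DGA: a graded subalgebra closed under the differential. -/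
structure SubDGA (A : CDGA.{u}) where
  toSubalgebra : Subalgebra ℚ A
  homogeneous : ∀ {x : A}, x ∈ toSubalgebra → ∀ i : ℕ,
    (DirectSum.decompose A.gr x i : A) ∈ toSubalgebra
  d_mem : ∀ {x : A}, x ∈ toSubalgebra → A.d x ∈ toSubalgebra

namespace SubDGA

variable {A : CDGA.{u}}

/-- The grading induced on a sub-DGA. -/
def gr (S : SubDGA A) (n : ℕ) : Submodule ℚ S.toSubalgebra :=
  (A.gr n).comap S.toSubalgebra.val.toLinearMap

/-- The homogeneous component of degree `i` of an element of a sub-DGA. -/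
def component (S : SubDGA A) (x : S.toSubalgebra) (i : ℕ) : S.gr i :=
  ⟨⟨(DirectSum.decompose A.gr (x : A) i : A), S.homogeneous x.2 i⟩,
    (DirectSum.decompose A.gr (x : A) i).2⟩

instance (S : SubDGA A) : SetLike.GradedMonoid S.gr where
  one_mem := SetLike.GradedOne.one_mem (A := A.gr)
  mul_mem _ _ _ _ hx hy := SetLike.GradedMul.mul_mem (A := A.gr) hx hy

theorem isInternal (S : SubDGA A) : DirectSum.IsInternal S.gr := by
  classical
  have key : ∀ (y : ⨁ i, S.gr i) (i : ℕ),
      (DirectSum.decompose A.gr ((DirectSum.coeAddMonoidHom S.gr y : S.toSubalgebra) : A) i : A)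
        = ((y i : S.toSubalgebra) : A) := by
    intro y i
    induction y using DirectSum.induction_on with
    | zero => simp
    | of j z =>
      rw [DirectSum.coeAddMonoidHom_of]
      by_cases h : j = i
      · subst h
        rw [DirectSum.of_eq_same]
        exact DirectSum.decompose_of_mem_same A.gr z.2
      · rw [DirectSum.of_eq_of_ne _ _ _ (Ne.symm h)]
        exact DirectSum.decompose_of_mem_ne A.gr z.2 h
    | add a b ha hb =>
      rw [map_add, DirectSum.add_apply]
      push_cast
      rw [DirectSum.decompose_add, DirectSum.add_apply]
      push_cast
      rw [ha, hb]
  constructor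
  · intro y z hyz
    refine DFinsupp.ext fun i => ?_
    apply Subtype.ext
    apply Subtype.ext
    rw [← key y i, ← key z i, hyz]
  · intro x
    refine ⟨∑ i ∈ (DirectSum.decompose A.gr (x : A)).support,
      DirectSum.of (fun i => S.gr i) i (S.component x i), ?_⟩
    rw [map_sum]
    apply Subtype.ext
    simp only [DirectSum.coeAddMonoidHom_of, AddSubmonoidClass.coe_finsetSum]
    exact DirectSum.sum_support_decompose A.gr (x : A)

instance (S : SubDGA A) : GradedAlgebra S.gr where
  toDecomposition := S.isInternal.chooseDecomposition

/-- A sub-DGA, regarded as a CDGA with the restricted structure. -/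
def toCDGA (S : SubDGA A) : CDGA.{u} where
  carrier := S.toSubalgebra
  gr := S.gr
  d := A.d.restrict (p := Subalgebra.toSubmodule S.toSubalgebra)
    (q := Subalgebra.toSubmodule S.toSubalgebra) (fun _ hx => S.d_mem hx)
  d_mem hx := A.d_mem hx
  d_d x := Subtype.ext (A.d_d x)
  leibniz y hx := Subtype.ext (A.leibniz (y : A) hx)
  graded_comm hx hy := Subtype.ext (A.graded_comm hx hy)

/-- The sub-DGA generated by a set: the smallest sub-DGA containing it. -/
def generated (A : CDGA.{u}) (X : Set A) : SubDGA A where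
  toSubalgebra := sInf {B | ∃ T : SubDGA A, T.toSubalgebra = B ∧ X ⊆ T.toSubalgebra}
  homogeneous := by
    intro x hx i
    rw [Algebra.mem_sInf] at hx ⊢
    rintro _ ⟨T, rfl, hT⟩
    exact T.homogeneous (hx _ ⟨T, rfl, hT⟩) i
  d_mem := by
    intro x hx
    rw [Algebra.mem_sInf] at hx ⊢
    rintro _ ⟨T, rfl, hT⟩
    exact T.d_mem (hx _ ⟨T, rfl, hT⟩)

end SubDGA

/-- For a minimal algebra `m`, this is `m_k`: the sub-DGA generated by the elements of
degree `≤ k`. -/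
def stage (m : CDGA.{u}) (k : ℕ) : SubDGA m :=
  SubDGA.generated m {x | ∃ i ≤ k, x ∈ m.gr i}

/-! ### Hirsch extensions and minimal algebras -/

/-- The relations `v w = (-1)^(n * n) w v` imposed on generators of degree `n`. -/
inductive FreeRel (n : ℕ) (V : Type u) [AddCommGroup V] [Module ℚ V] :
    TensorAlgebra ℚ V → TensorAlgebra ℚ V → Prop
  | comm (x y : V) : FreeRel n V
      (TensorAlgebra.ι ℚ x * TensorAlgebra.ι ℚ y)
      ((-1 : ℚ) ^ (n * n) • (TensorAlgebra.ι ℚ y * TensorAlgebra.ι ℚ x))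

/-- The free graded commutative algebra `Λ(V)` on a rational vector space `V` placed in degree `n`
(the symmetric algebra if `n` is even, the exterior algebra if `n` is odd). -/
abbrev FreeGC (n : ℕ) (V : Type u) [AddCommGroup V] [Module ℚ V] : Type u :=
  RingQuot (FreeRel n V)

/-- The algebra map `Λ(V) → A` extending the inclusion of a subspace `V` of `A` of degree `n`. -/
def freeMap (A : CDGA.{u}) (n : ℕ) (V : Submodule ℚ A) (hV : V ≤ A.gr n) :
    FreeGC n V →ₐ[ℚ] A :=
  RingQuot.liftAlgHom ℚ ⟨TensorAlgebra.lift ℚ V.subtype, by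
    intro a b h
    induction h with
    | comm x y =>
      simp only [map_mul, map_smul, TensorAlgebra.lift_ι_apply, Submodule.subtype_apply]
      exact A.graded_comm (hV x.2) (hV y.2)⟩

/-- The multiplication map `S ⊗ Λ(V) → A`, `s ⊗ w ↦ s w`. -/
def hirschMap {A : CDGA.{u}} (S : SubDGA A) (n : ℕ) (V : Submodule ℚ A) (hV : V ≤ A.gr n) :
    S.toSubalgebra ⊗[ℚ] FreeGC n V →ₗ[ℚ] A :=
  LinearMap.mul' ℚ A ∘ₗ
    TensorProduct.map S.toSubalgebra.val.toLinearMap (A.freeMap n V hV).toLinearMap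

/-- The inclusion `S ⊆ T` of sub-DGAs is a Hirsch extension of degree `n`: there is a space `V` of
elements of degree `n`, with `d V ⊆ S`, such that `T = S ⊗ Λ(V)`. -/
def IsHirschExtension {A : CDGA.{u}} (n : ℕ) (S T : SubDGA A) : Prop :=
  ∃ (V : Submodule ℚ A) (hV : V ≤ A.gr n),
    (∀ v ∈ V, A.d v ∈ S.toSubalgebra) ∧
    Function.Injective (hirschMap S n V hV) ∧
    LinearMap.range (hirschMap S n V hV) = Subalgebra.toSubmodule T.toSubalgebra

/-- A minimal algebra: an increasing union of sub-DGAs `M 0 ⊆ M 1 ⊆ ⋯` with `M 0 = M 1 = ℚ`, in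
which `M k ⊆ M (k + 1)` is a Hirsch extension by generators of degree `k + 1`. In particular
it is free as a graded commutative algebra. -/
def IsMinimal (m : CDGA.{u}) : Prop :=
  Nontrivial m ∧ ∃ M : ℕ → SubDGA m,
    (M 0).toSubalgebra = ⊥ ∧ (M 1).toSubalgebra = ⊥ ∧
    (∀ k, IsHirschExtension (k + 1) (M k) (M (k + 1))) ∧
    (∀ x : m, ∃ k, x ∈ (M k).toSubalgebra)

end CDGA

end

universe w

namespace CDGA

/-! The given morphism `f` is itself an isomorphism: by induction on `j ≤ k + 1` it restricts to a
bijection of the `j`-th stages, starting from `ℚ`. Suppose this holds for `j`. Degree `j + 1`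
consists of the new generators plus elements of stage `j`, so `d` maps it into stage `j`. A diagram
chase using bijectivity on `H^(j+1)` and injectivity on `H^(j+2)` then makes `f` bijective in degree
`j + 1` (`eq_zero_of_mem_gr`, `exists_of_mem_gr`). Since the target stage `j + 1` is stage `j`
tensored with `Λ(V')`, the inverses on stage `j` and on `V'` extend to a linear left inverse of `f`
there, while surjectivity follows by lifting generators (`Hom.BijectiveOnStage.succ`).
`IsMinimal.stage_zero_and_exists_isGenerators` transfers the Hirsch structure to the canonical
stages. -/

theorem freeMap_mem_adjoin (A : CDGA.{u}) (n : ℕ) (V : Submodule ℚ A) (hV : V ≤ A.gr n)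
    (w : FreeGC n V) : A.freeMap n V hV w ∈ Algebra.adjoin ℚ (V : Set A) := by
  obtain ⟨t, rfl⟩ := RingQuot.mkAlgHom_surjective ℚ (FreeRel n V) w
  have h : A.freeMap n V hV (RingQuot.mkAlgHom ℚ (FreeRel n V) t) =
      TensorAlgebra.lift ℚ V.subtype t := by
    simp [freeMap]
  have h2 := TensorAlgebra.range_lift (R := ℚ) V.subtype
  rw [h, ← Subtype.range_coe (s := (V : Set A))]
  exact h2.le ⟨t, rfl⟩

/-- The generator of `Λ(V)` given by an element of `V`. -/
noncomputable def FreeGC.ι (n : ℕ) {V : Type u} [AddCommGroup V] [Module ℚ V] (x : V) :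
    FreeGC n V :=
  RingQuot.mkAlgHom ℚ (FreeRel n V) (TensorAlgebra.ι ℚ x)

theorem freeMap_ι (A : CDGA.{u}) (n : ℕ) (V : Submodule ℚ A) (hV : V ≤ A.gr n) (x : V) :
    A.freeMap n V hV (FreeGC.ι n x) = x := by
  simp [freeMap, FreeGC.ι]

/-! ### Induction and extension along the multiplication map. -/

theorem hirschMap_tmul {A : CDGA.{u}} (S : SubDGA A) (n : ℕ) (V : Submodule ℚ A)
    (hV : V ≤ A.gr n) (s : S.toSubalgebra) (w : FreeGC n V) :
    hirschMap S n V hV (s ⊗ₜ w) = s * A.freeMap n V hV w := by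
  simp [hirschMap]

/-- Induction principle for Hirsch extensions: stability under right multiplication by `V` passes to
the subalgebra generated by `V`, which contains the image of `Λ(V)`. -/
theorem range_hirschMap_le {A : CDGA.{u}} (S : SubDGA A) (n : ℕ) (V : Submodule ℚ A)
    (hV : V ≤ A.gr n) (R : Submodule ℚ A) (hS : ∀ s ∈ S.toSubalgebra, s ∈ R)
    (hR : ∀ r ∈ R, ∀ v ∈ V, r * v ∈ R) :
    LinearMap.range (hirschMap S n V hV) ≤ R := by
  have key : ∀ x ∈ Algebra.adjoin ℚ (V : Set A), ∀ r ∈ R, r * x ∈ R := by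
    intro x hx
    induction hx using Algebra.adjoin_induction with
    | mem x hx => exact fun r hr => hR r hr x hx
    | algebraMap q =>
      intro r hr
      rw [← Algebra.commutes, ← Algebra.smul_def]
      exact R.smul_mem q hr
    | add x y _ _ hx hy =>
      intro r hr
      rw [mul_add]
      exact R.add_mem (hx r hr) (hy r hr)
    | mul x y _ _ hx hy =>
      intro r hr
      rw [← mul_assoc]
      exact hy _ (hx r hr)
  rintro _ ⟨t, rfl⟩
  induction t using TensorProduct.induction_on with
  | zero => simp
  | tmul s w =>
    rw [hirschMap_tmul]
    exact key _ (freeMap_mem_adjoin A n V hV w) _ (hS s s.2)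
  | add x y hx hy =>
    rw [map_add]
    exact R.add_mem hx hy

theorem mem_range_hirschMap_of_mem {A : CDGA.{u}} (S : SubDGA A) (n : ℕ) (V : Submodule ℚ A)
    (hV : V ≤ A.gr n) {s : A} (hs : s ∈ S.toSubalgebra) :
    s ∈ LinearMap.range (hirschMap S n V hV) :=
  ⟨⟨s, hs⟩ ⊗ₜ 1, by simp [hirschMap_tmul]⟩

/-- A linear map on `S` and a graded commutative linear map on `V` extend to `S ⊗ Λ(V)`. -/
theorem exists_lift_of_hirschMap_injective {A : CDGA.{u}} (S : SubDGA A) (n : ℕ)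
    (V : Submodule ℚ A) (hV : V ≤ A.gr n) (hinj : Function.Injective (hirschMap S n V hV))
    {C : Type w} [Ring C] [Algebra ℚ C] (a : S.toSubalgebra →ₗ[ℚ] C) (b : V →ₗ[ℚ] C)
    (hb : ∀ x y, b x * b y = (-1 : ℚ) ^ (n * n) • (b y * b x)) :
    ∃ g : A →ₗ[ℚ] C, (∀ s : S.toSubalgebra, g s = a s) ∧
      ∀ t ∈ LinearMap.range (hirschMap S n V hV), ∀ v : V, g (t * v) = g t * b v := by
  let ψ : FreeGC n V →ₐ[ℚ] C := RingQuot.liftAlgHom ℚ ⟨TensorAlgebra.lift ℚ b, by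
    intro x y h
    induction h with
    | comm x y =>
      simp only [map_mul, map_smul, TensorAlgebra.lift_ι_apply]
      exact hb x y⟩
  have hψ : ∀ x, ψ (FreeGC.ι n x) = b x := fun x => by simp [ψ, FreeGC.ι]
  -- `r` is arbitrary off the range, which makes `g` total; its values are controlled only on the
  -- range.
  obtain ⟨r, hr⟩ := LinearMap.exists_leftInverse_of_injective (hirschMap S n V hV)
    (LinearMap.ker_eq_bot.2 hinj)
  have hr' : ∀ t, r (hirschMap S n V hV t) = t := fun t => LinearMap.congr_fun hr t
  let G := LinearMap.mul' ℚ C ∘ₗ TensorProduct.map a ψ.toLinearMap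
  have hG : ∀ (s : S.toSubalgebra) w, (G ∘ₗ r) (s * A.freeMap n V hV w) = a s * ψ w := by
    intro s w
    rw [← hirschMap_tmul, LinearMap.comp_apply, hr']
    simp [G]
  refine ⟨G ∘ₗ r, fun s => by simpa using hG s 1, ?_⟩
  rintro _ ⟨t, rfl⟩ v
  induction t using TensorProduct.induction_on with
  | zero => simp
  | tmul s w =>
    rw [hirschMap_tmul, hG, mul_assoc, ← freeMap_ι A n V hV v, ← map_mul, hG, map_mul, hψ,
      mul_assoc]
  | add x y hx hy => rw [map_add, add_mul, map_add, hx, hy, map_add, add_mul]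

/-! ### Low degrees of a Hirsch extension -/

theorem SubDGA.ext {A : CDGA.{u}} {S T : SubDGA A} (h : S.toSubalgebra = T.toSubalgebra) :
    S = T := by
  cases S
  cases T
  cases h
  rfl

theorem SubDGA.toSubalgebra_generated_le {A : CDGA.{u}} {X : Set A} {T : SubDGA A}
    (h : X ⊆ T.toSubalgebra) : (SubDGA.generated A X).toSubalgebra ≤ T.toSubalgebra :=
  sInf_le ⟨T, rfl, h⟩

theorem SubDGA.subset_generated {A : CDGA.{u}} (X : Set A) :
    X ⊆ (SubDGA.generated A X).toSubalgebra := by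
  intro x hx
  change x ∈ (sInf _ : Subalgebra ℚ A)
  rw [Algebra.mem_sInf]
  rintro _ ⟨T, rfl, hT⟩
  exact hT hx

theorem gr_le_stage (m : CDGA.{u}) {i j : ℕ} (h : i ≤ j) {x : m} (hx : x ∈ m.gr i) :
    x ∈ (m.stage j).toSubalgebra :=
  SubDGA.subset_generated _ ⟨i, h, hx⟩

theorem stage_mono (m : CDGA.{u}) {i j : ℕ} (h : i ≤ j) :
    (m.stage i).toSubalgebra ≤ (m.stage j).toSubalgebra :=
  SubDGA.toSubalgebra_generated_le fun _ ⟨_, hl, hx⟩ => gr_le_stage m (hl.trans h) hx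

/-- A product `r * v` with `v` of degree `n + 1` has no component in degree `≤ n`, and its component
in degree `n + 1` is `r₀ * v`, where `r₀` is a scalar by `h0`. -/
theorem decompose_mem_of_mem_range_hirschMap {A : CDGA.{u}} (S : SubDGA A) (n : ℕ)
    (V : Submodule ℚ A) (hV : V ≤ A.gr (n + 1))
    (h0 : ∀ x ∈ S.toSubalgebra, x ∈ A.gr 0 → x ∈ (⊥ : Subalgebra ℚ A))
    {x : A} (hx : x ∈ LinearMap.range (hirschMap S (n + 1) V hV)) :
    (∀ i ≤ n, (DirectSum.decompose A.gr x i : A) ∈ S.toSubalgebra) ∧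
      (DirectSum.decompose A.gr x (n + 1) : A) ∈ Subalgebra.toSubmodule S.toSubalgebra ⊔ V := by
  let R : Submodule ℚ A :=
    { carrier := {x | (∀ i ≤ n, (DirectSum.decompose A.gr x i : A) ∈ S.toSubalgebra) ∧
        (DirectSum.decompose A.gr x (n + 1) : A) ∈ Subalgebra.toSubmodule S.toSubalgebra ⊔ V}
      zero_mem' := by simp
      add_mem' := by
        rintro a b ⟨ha, ha'⟩ ⟨hb, hb'⟩
        constructor
        · intro i hi
          simpa using add_mem (ha i hi) (hb i hi)
        · simpa using add_mem ha' hb'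
      smul_mem' := by
        rintro q a ⟨ha, ha'⟩
        constructor
        · intro i hi
          rw [DirectSum.decompose_smul]
          exact S.toSubalgebra.smul_mem (ha i hi) q
        · rw [DirectSum.decompose_smul]
          exact Submodule.smul_mem _ q ha' }
  refine range_hirschMap_le S (n + 1) V hV R ?_ ?_ hx
  · intro s hs
    exact ⟨fun i _ => S.homogeneous hs i,
      Submodule.mem_sup_left (S.homogeneous hs (n + 1))⟩
  · rintro r ⟨hr, -⟩ v hv
    constructor
    · intro i hi
      rw [DirectSum.coe_decompose_mul_of_right_mem_of_not_le A.gr (hV hv) (by omega)]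
      exact zero_mem _
    · rw [DirectSum.coe_decompose_mul_of_right_mem_of_le A.gr (hV hv) le_rfl, Nat.sub_self]
      obtain ⟨q, hq⟩ := Algebra.mem_bot.1
        (h0 _ (hr 0 (Nat.zero_le _)) (DirectSum.decompose A.gr r 0).2)
      rw [← hq, ← Algebra.smul_def]
      exact Submodule.mem_sup_right (V.smul_mem q hv)

theorem IsHirschExtension.le {A : CDGA.{u}} {n : ℕ} {S T : SubDGA A}
    (h : IsHirschExtension n S T) : S.toSubalgebra ≤ T.toSubalgebra := by
  obtain ⟨V, hV, -, -, hr⟩ := h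
  intro x hx
  have := mem_range_hirschMap_of_mem S n V hV hx
  rwa [hr] at this

/-! ### The canonical filtration of a minimal algebra. -/

/-- The properties of the generators of one step of the canonical filtration. -/
structure IsGenerators (m : CDGA.{u}) (j : ℕ) (V : Submodule ℚ m) : Prop where
  le_gr : V ≤ m.gr (j + 1)
  d_mem : ∀ v ∈ V, m.d v ∈ (m.stage j).toSubalgebra
  injective : Function.Injective (hirschMap (m.stage j) (j + 1) V le_gr)
  range_eq : LinearMap.range (hirschMap (m.stage j) (j + 1) V le_gr) =
    Subalgebra.toSubmodule (m.stage (j + 1)).toSubalgebra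
  gr_le : m.gr (j + 1) ≤ Subalgebra.toSubmodule (m.stage j).toSubalgebra ⊔ V

/-- Any filtration `M` witnessing minimality is the canonical one: steps after `M j` add nothing in
degrees `≤ j`, and `M (j + 1)` is generated over `M j` in degree `j + 1`. -/
theorem IsMinimal.stage_zero_and_exists_isGenerators {m : CDGA.{u}} (hm : m.IsMinimal) :
    (m.stage 0).toSubalgebra = ⊥ ∧ ∀ j, ∃ V, m.IsGenerators j V := by
  obtain ⟨-, M, h0, -, hM, hU⟩ := hm
  have hbot : ∀ j, ∀ x ∈ (M j).toSubalgebra, x ∈ m.gr 0 → x ∈ (⊥ : Subalgebra ℚ m) := by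
    intro j
    induction j with
    | zero => intro x hx _; rwa [h0] at hx
    | succ j ih =>
      intro x hx hx0
      obtain ⟨V, hV, -, -, hr⟩ := hM j
      have hx' : x ∈ LinearMap.range (hirschMap (M j) (j + 1) V hV) := by rw [hr]; exact hx
      have := (decompose_mem_of_mem_range_hirschMap (M j) j V hV ih hx').1 0 (Nat.zero_le _)
      rw [DirectSum.decompose_of_mem_same _ hx0] at this
      exact ih x this hx0
  have hmono : Monotone fun j => (M j).toSubalgebra :=
    monotone_nat_of_le_succ fun j => (hM j).le
  have hdown : ∀ {i j : ℕ} {x : m}, x ∈ m.gr i → i ≤ j → ∀ l, x ∈ (M (j + l)).toSubalgebra →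
      x ∈ (M j).toSubalgebra := by
    intro i j x hx hij l
    induction l with
    | zero => exact id
    | succ l ih =>
      intro h
      obtain ⟨V, hV, -, -, hr⟩ := hM (j + l)
      have hx' : x ∈ LinearMap.range (hirschMap (M (j + l)) (j + l + 1) V hV) := by
        rw [hr]; exact h
      have := (decompose_mem_of_mem_range_hirschMap (M (j + l)) (j + l) V hV (hbot _) hx').1 i
        (by omega)
      rw [DirectSum.decompose_of_mem_same _ hx] at this
      exact ih this
  have hgr : ∀ {i j : ℕ} {x : m}, i ≤ j → x ∈ m.gr i → x ∈ (M j).toSubalgebra := by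
    intro i j x hij hx
    obtain ⟨l, hl⟩ := hU x
    exact hdown hx hij l (hmono (Nat.le_add_left l j) hl)
  have hstage : ∀ j, m.stage j = M j := by
    intro j
    apply SubDGA.ext
    apply le_antisymm
    · exact SubDGA.toSubalgebra_generated_le fun x ⟨i, hi, hx⟩ => hgr hi hx
    · induction j with
      | zero => rw [h0]; exact bot_le
      | succ j ih =>
        obtain ⟨V, hV, -, -, hr⟩ := hM j
        change Subalgebra.toSubmodule (M (j + 1)).toSubalgebra ≤
          Subalgebra.toSubmodule (m.stage (j + 1)).toSubalgebra
        rw [← hr]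
        refine range_hirschMap_le _ _ _ _ _ ?_ ?_
        · exact fun s hs => stage_mono m (Nat.le_succ j) (ih hs)
        · exact fun r hr v hv => (m.stage (j + 1)).toSubalgebra.mul_mem hr (gr_le_stage m le_rfl (hV hv))
  refine ⟨by rw [hstage, h0], fun j => ?_⟩
  obtain ⟨V, hV, hd, hi, hr⟩ := hM j
  rw [← hstage, ← hstage] at hr
  rw [← hstage] at hi hd
  refine ⟨V, hV, hd, hi, hr, fun x hx => ?_⟩
  have hx' : x ∈ LinearMap.range (hirschMap (m.stage j) (j + 1) V hV) := by
    rw [hr]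
    exact gr_le_stage m le_rfl hx
  have := (decompose_mem_of_mem_range_hirschMap (m.stage j) j V hV
    (by rw [hstage]; exact hbot j) hx').2
  rwa [DirectSum.decompose_of_mem_same _ hx] at this

theorem IsGenerators.d_mem_stage {m : CDGA.{u}} {j : ℕ} {V : Submodule ℚ m}
    (h : m.IsGenerators j V) {x : m} (hx : x ∈ m.gr (j + 1)) :
    m.d x ∈ (m.stage j).toSubalgebra := by
  obtain ⟨s, hs, v, hv, rfl⟩ := Submodule.mem_sup.1 (h.gr_le hx)
  rw [map_add]
  exact add_mem ((m.stage j).d_mem hs) (h.d_mem v hv)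

/-! ### Homogeneous primitives, isomorphisms and cohomology classes. -/

theorem d_decompose (A : CDGA.{u}) (x : A) (i : ℕ) :
    A.d (DirectSum.decompose A.gr x i) = DirectSum.decompose A.gr (A.d x) (i + 1) := by
  induction x using DirectSum.Decomposition.inductionOn A.gr with
  | zero => simp
  | @homogeneous j x =>
    by_cases h : j = i
    · subst h
      rw [DirectSum.decompose_of_mem_same _ x.2, DirectSum.decompose_of_mem_same _ (A.d_mem x.2)]
    · rw [DirectSum.decompose_of_mem_ne _ x.2 h,
        DirectSum.decompose_of_mem_ne _ (A.d_mem x.2) (by omega), map_zero]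
  | add x y hx hy => simp [hx, hy]

/-- Coboundaries are defined with arbitrary primitives; homogeneity of `d` allows replacing one by
its degree `i` component. -/
theorem exists_d_eq_of_mem_gr {A : CDGA.{u}} {i : ℕ} {x y : A} (hx : x ∈ A.gr (i + 1))
    (h : x = A.d y) : ∃ z ∈ A.gr i, x = A.d z :=
  ⟨_, (DirectSum.decompose A.gr y i).2, by
    rw [d_decompose, ← h, DirectSum.decompose_of_mem_same _ hx]⟩

theorem Hom.map_decompose {A : CDGA.{u}} {B : CDGA.{v}} (f : Hom A B) (x : A) (i : ℕ) :
    f.toAlgHom (DirectSum.decompose A.gr x i) = DirectSum.decompose B.gr (f.toAlgHom x) i := by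
  induction x using DirectSum.Decomposition.inductionOn A.gr with
  | zero => simp
  | @homogeneous j x =>
    by_cases h : j = i
    · subst h
      rw [DirectSum.decompose_of_mem_same _ x.2,
        DirectSum.decompose_of_mem_same _ (f.map_gr x.2)]
    · rw [DirectSum.decompose_of_mem_ne _ x.2 h,
        DirectSum.decompose_of_mem_ne _ (f.map_gr x.2) h, map_zero]
  | add x y hx hy => simp [hx, hy]

theorem isomorphic_of_bijective {A : CDGA.{u}} {B : CDGA.{v}} (f : Hom A B)
    (hf : Function.Bijective f.toAlgHom) : Isomorphic A B := by
  let e := AlgEquiv.ofBijective f.toAlgHom hf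
  have he : ∀ y, f.toAlgHom (e.symm y) = y := e.apply_symm_apply
  refine ⟨f, ⟨e.symm.toAlgHom, ?_, ?_⟩, e.symm_apply_apply, he⟩
  · intro n y hy
    have h := f.map_decompose (e.symm y) n
    rw [he, DirectSum.decompose_of_mem_same _ hy] at h
    have h2 : e.symm y = DirectSum.decompose A.gr (e.symm y) n :=
      hf.1 (by rw [h, he])
    change e.symm y ∈ A.gr n
    rw [h2]
    exact (DirectSum.decompose A.gr (e.symm y) n).2
  · intro y
    apply hf.1
    change f.toAlgHom (e.symm (B.d y)) = f.toAlgHom (A.d (e.symm y))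
    rw [f.map_d, he, he]

theorem Hom.exists_d_eq_of_injective {A : CDGA.{u}} {B : CDGA.{v}} (f : Hom A B) {i : ℕ}
    (hf : Function.Injective (f.cohomologyMap i)) {x : A} (hx : x ∈ A.gr i) (hdx : A.d x = 0)
    {y : B} (hy : f.toAlgHom x = B.d y) : ∃ z, x = A.d z := by
  let c : A.cocycles i := ⟨x, hx, hdx⟩
  have h : f.cohomologyMap i (Submodule.Quotient.mk c) = 0 := by
    change Submodule.Quotient.mk (f.cocyclesMap i c) = (0 : B.cohomology i)
    rw [Submodule.Quotient.mk_eq_zero]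
    exact ⟨y, hy.symm⟩
  have h2 := (map_eq_zero_iff _ hf).1 h
  rw [Submodule.Quotient.mk_eq_zero] at h2
  obtain ⟨z, hz⟩ := h2
  exact ⟨z, hz.symm⟩

theorem Hom.exists_sub_eq_d_of_surjective {A : CDGA.{u}} {B : CDGA.{v}} (f : Hom A B) {i : ℕ}
    (hf : Function.Surjective (f.cohomologyMap i)) {y : B} (hy : y ∈ B.gr i) (hdy : B.d y = 0) :
    ∃ x ∈ A.gr i, ∃ b, y - f.toAlgHom x = B.d b := by
  let c : B.cocycles i := ⟨y, hy, hdy⟩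
  obtain ⟨t, ht⟩ := hf (Submodule.Quotient.mk c)
  obtain ⟨x, rfl⟩ := Submodule.Quotient.mk_surjective _ t
  have h : (Submodule.Quotient.mk c : B.cohomology i) =
    Submodule.Quotient.mk (f.cocyclesMap i x) := ht.symm
  rw [Submodule.Quotient.eq] at h
  obtain ⟨b, hb⟩ := h
  exact ⟨x, x.2.1, b, hb.symm⟩

/-- Inverts `φ` over `W` with values in `P`; the image of `P` may be larger than `W`, as it can be
for `P` the degree `j + 1` part and `W` the generators. -/
theorem exists_linear_section {K : Type*} [Field K] {E F : Type*} [AddCommGroup E] [Module K E]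
    [AddCommGroup F] [Module K F] (φ : E →ₗ[K] F) (P : Submodule K E) (W : Submodule K F)
    (hinj : ∀ x ∈ P, φ x = 0 → x = 0) (hW : ∀ y ∈ W, ∃ x ∈ P, φ x = y) :
    ∃ b : W →ₗ[K] E, ∀ w : W, b w ∈ P ∧ φ (b w) = w := by
  have hi : Function.Injective (φ.domRestrict P) := by
    rw [injective_iff_map_eq_zero]
    exact fun x hx => Subtype.ext (hinj x x.2 hx)
  let e := LinearEquiv.ofInjective (φ.domRestrict P) hi
  have hle : W ≤ LinearMap.range (φ.domRestrict P) := fun y hy => by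
    obtain ⟨x, hx, rfl⟩ := hW y hy
    exact ⟨⟨x, hx⟩, rfl⟩
  refine ⟨P.subtype ∘ₗ e.symm.toLinearMap ∘ₗ Submodule.inclusion hle, fun w => ⟨?_, ?_⟩⟩
  · exact (e.symm (Submodule.inclusion hle w)).2
  · exact congrArg Subtype.val (e.apply_symm_apply (Submodule.inclusion hle w))

/-! ### Stages inside a larger stage -/

/-- The inclusion of a sub-DGA. -/
noncomputable def SubDGA.incl {A : CDGA.{u}} (S : SubDGA A) : Hom S.toCDGA A where
  toAlgHom := S.toSubalgebra.val
  map_gr hx := hx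
  map_d _ := rfl

theorem SubDGA.incl_injective {A : CDGA.{u}} (S : SubDGA A) :
    Function.Injective S.incl.toAlgHom :=
  Subtype.val_injective

/-- The `j`-th stage as a subalgebra of the `n`-th one. -/
noncomputable def stageIn (m : CDGA.{u}) (n j : ℕ) : Subalgebra ℚ (m.stage n).toCDGA :=
  (m.stage j).toSubalgebra.comap (m.stage n).incl.toAlgHom

theorem stageIn_mono (m : CDGA.{u}) (n : ℕ) {i j : ℕ} (h : i ≤ j) : m.stageIn n i ≤ m.stageIn n j :=
  fun _ hx => stage_mono m h hx

theorem mem_stageIn_of_mem_gr {m : CDGA.{u}} {n i j : ℕ} (h : i ≤ j) {x : (m.stage n).toCDGA}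
    (hx : x ∈ (m.stage n).toCDGA.gr i) : x ∈ m.stageIn n j :=
  gr_le_stage m h hx

theorem d_mem_stageIn {m : CDGA.{u}} {n j : ℕ} {x : (m.stage n).toCDGA}
    (hx : x ∈ m.stageIn n j) : (m.stage n).toCDGA.d x ∈ m.stageIn n j :=
  (m.stage j).d_mem hx

theorem decompose_mem_stageIn {m : CDGA.{u}} {n j : ℕ} {x : (m.stage n).toCDGA}
    (hx : x ∈ m.stageIn n j) (i : ℕ) :
    (DirectSum.decompose (m.stage n).toCDGA.gr x i : (m.stage n).toCDGA) ∈ m.stageIn n j := by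
  change (m.stage n).incl.toAlgHom _ ∈ (m.stage j).toSubalgebra
  rw [Hom.map_decompose]
  exact (m.stage j).homogeneous hx i

/-- An induction principle for the elements of the next stage, inside a larger one. -/
theorem IsGenerators.mem_of_mem_stageIn_succ {m : CDGA.{u}} {n j : ℕ} {V : Submodule ℚ m}
    (h : m.IsGenerators j V) (hjn : j + 1 ≤ n) (Q : Submodule ℚ (m.stage n).toCDGA)
    (hS : ∀ x ∈ m.stageIn n j, x ∈ Q)
    (hQ : ∀ x ∈ Q, ∀ v, (m.stage n).incl.toAlgHom v ∈ V → x * v ∈ Q)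
    {x : (m.stage n).toCDGA} (hx : x ∈ m.stageIn n (j + 1)) : x ∈ Q := by
  have hle := range_hirschMap_le (m.stage j) (j + 1) V h.le_gr
    (Q.map (m.stage n).incl.toAlgHom.toLinearMap)
    (fun s hs => ⟨⟨s, stage_mono m (by omega) hs⟩, hS _ hs, rfl⟩)
    (by
      rintro _ ⟨r, hr, rfl⟩ v hv
      have hvn := gr_le_stage m hjn (h.le_gr hv)
      exact ⟨r * ⟨v, hvn⟩, hQ r hr ⟨v, hvn⟩ hv, rfl⟩)
  rw [h.range_eq] at hle
  obtain ⟨y, hy, hyx⟩ := hle hx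
  rwa [← (m.stage n).incl_injective hyx]

/-! ### The inductive step -/

section Step

variable {m : CDGA.{u}} {m' : CDGA.{v}} {n : ℕ}
  (f : Hom (m.stage n).toCDGA (m'.stage n).toCDGA)

/-- A morphism of stages restricts to an isomorphism of the `j`-th stages. -/
structure Hom.BijectiveOnStage (j : ℕ) : Prop where
  mapsTo : ∀ x ∈ m.stageIn n j, f.toAlgHom x ∈ m'.stageIn n j
  eq_zero : ∀ x ∈ m.stageIn n j, f.toAlgHom x = 0 → x = 0
  surj : ∀ y ∈ m'.stageIn n j, ∃ x ∈ m.stageIn n j, f.toAlgHom x = y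

variable {f} {j : ℕ} {V : Submodule ℚ m} {V' : Submodule ℚ m'}

theorem Hom.BijectiveOnStage.exists_mem_gr (hj : f.BijectiveOnStage j) {i : ℕ}
    {y : (m'.stage n).toCDGA} (hy : y ∈ m'.stageIn n j) (hyi : y ∈ (m'.stage n).toCDGA.gr i) :
    ∃ x ∈ m.stageIn n j, x ∈ (m.stage n).toCDGA.gr i ∧ f.toAlgHom x = y := by
  obtain ⟨x, hx, rfl⟩ := hj.surj y hy
  refine ⟨_, decompose_mem_stageIn hx i, SetLike.coe_mem _, ?_⟩
  rw [f.map_decompose, DirectSum.decompose_of_mem_same _ hyi]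

/-- `d x` lies in stage `j` and maps to zero, so `x` is a cocycle. Its class dies, hence `x = d z`
with `z` of degree `j`; thus `x` lies in stage `j`, where `f` is injective. -/
theorem Hom.BijectiveOnStage.eq_zero_of_mem_gr (hj : f.BijectiveOnStage j)
    (hV : m.IsGenerators j V) (hf : Function.Injective (f.cohomologyMap (j + 1)))
    {x : (m.stage n).toCDGA} (hx : x ∈ (m.stage n).toCDGA.gr (j + 1))
    (h : f.toAlgHom x = 0) : x = 0 := by
  have hdx : (m.stage n).toCDGA.d x = 0 :=
    hj.eq_zero _ (hV.d_mem_stage hx) (by rw [f.map_d, h, map_zero])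
  obtain ⟨y, hy⟩ := f.exists_d_eq_of_injective hf hx hdx (y := 0) (by rw [h, map_zero])
  obtain ⟨z, hz, rfl⟩ := exists_d_eq_of_mem_gr hx hy
  exact hj.eq_zero _ (d_mem_stageIn (mem_stageIn_of_mem_gr le_rfl hz)) h

/-- Lift `d y` to a cocycle `c` of stage `j`. Injectivity on `H^(j+2)` gives `c = d t`, so `y - f t`
is a cocycle; it is `f z` up to the differential of an element of degree `j`, which lifts to some
`a`. The preimage is `t + z + d a`. -/
theorem Hom.BijectiveOnStage.exists_of_mem_gr (hj : f.BijectiveOnStage j)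
    (hV' : m'.IsGenerators j V') (hf : Function.Surjective (f.cohomologyMap (j + 1)))
    (hf' : Function.Injective (f.cohomologyMap (j + 2)))
    {y : (m'.stage n).toCDGA} (hy : y ∈ (m'.stage n).toCDGA.gr (j + 1)) :
    ∃ x ∈ (m.stage n).toCDGA.gr (j + 1), f.toAlgHom x = y := by
  obtain ⟨c, hc, hcg, hcy⟩ := hj.exists_mem_gr (hV'.d_mem_stage hy) ((m'.stage n).toCDGA.d_mem hy)
  have hc0 : (m.stage n).toCDGA.d c = 0 :=
    hj.eq_zero _ (d_mem_stageIn hc) (by rw [f.map_d, hcy, d_d])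
  obtain ⟨t, ht⟩ := f.exists_d_eq_of_injective hf' hcg hc0 hcy
  obtain ⟨t, htm, rfl⟩ := exists_d_eq_of_mem_gr hcg ht
  rw [f.map_d] at hcy
  obtain ⟨z, hz, b, hb⟩ := f.exists_sub_eq_d_of_surjective hf
    (sub_mem hy (f.map_gr htm)) (by rw [map_sub, hcy, sub_self])
  obtain ⟨b, hbm, hb⟩ := exists_d_eq_of_mem_gr
    (sub_mem (sub_mem hy (f.map_gr htm)) (f.map_gr hz)) hb
  obtain ⟨a, -, ha, rfl⟩ := hj.exists_mem_gr (mem_stageIn_of_mem_gr le_rfl hbm) hbm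
  refine ⟨t + z + (m.stage n).toCDGA.d a,
    add_mem (add_mem htm hz) ((m.stage n).toCDGA.d_mem ha), ?_⟩
  rw [map_add, map_add, f.map_d, ← hb]
  abel

theorem Hom.BijectiveOnStage.succ (hj : f.BijectiveOnStage j) (hjn : j + 1 ≤ n)
    (hV : m.IsGenerators j V) (hV' : m'.IsGenerators j V')
    (hf : Function.Bijective (f.cohomologyMap (j + 1)))
    (hf' : Function.Injective (f.cohomologyMap (j + 2))) : f.BijectiveOnStage (j + 1) := by
  let A := (m.stage n).toCDGA
  let φ : A →ₐ[ℚ] m' := (m'.stage n).incl.toAlgHom.comp f.toAlgHom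
  have hφ0 : ∀ x, φ x = 0 → f.toAlgHom x = 0 := fun x h => Subtype.ext h
  have hle' : (m'.stage j).toSubalgebra ≤ (m'.stage n).toSubalgebra := stage_mono m' (by omega)
  have hVn' : ∀ v ∈ V', v ∈ (m'.stage n).toSubalgebra :=
    fun v hv => gr_le_stage m' hjn (hV'.le_gr hv)
  have hsucc' := stage_mono m' (Nat.le_succ j)
  -- sections of `φ` over the stage `j` and over the generators
  obtain ⟨a, ha⟩ := exists_linear_section φ.toLinearMap (Subalgebra.toSubmodule (m.stageIn n j))
    (Subalgebra.toSubmodule (m'.stage j).toSubalgebra)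
    (fun x hx h => hj.eq_zero x hx (hφ0 x h))
    (fun y hy => by
      obtain ⟨x, hx, hxy⟩ := hj.surj ⟨y, hle' hy⟩ hy
      exact ⟨x, hx, congrArg Subtype.val hxy⟩)
  obtain ⟨b, hb⟩ := exists_linear_section φ.toLinearMap (A.gr (j + 1)) V'
    (fun x hx h => hj.eq_zero_of_mem_gr hV hf.1 hx (hφ0 x h))
    (fun y hy => by
      obtain ⟨x, hx, hxy⟩ := hj.exists_of_mem_gr hV' hf.2 hf'
        (y := ⟨y, hVn' y hy⟩) (hV'.le_gr hy)
      exact ⟨x, hx, congrArg Subtype.val hxy⟩)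
  -- Freeness of the target glues the two sections into `g`, so far multiplicative only against `V'`
  -- on the right.
  obtain ⟨g, hga, hgb⟩ := exists_lift_of_hirschMap_injective (m'.stage j) (j + 1) V' hV'.le_gr
    hV'.injective a b (fun x y => A.graded_comm (hb x).1 (hb y).1)
  rw [hV'.range_eq] at hgb
  -- `g` inverts `φ` on the stage `j`
  have hgφ : ∀ x ∈ m.stageIn n j, g (φ x) = x := by
    intro x hx
    have h1 : g (φ x) = _ := hga ⟨φ x, hj.mapsTo x hx⟩
    have h2 := ha ⟨φ x, hj.mapsTo x hx⟩
    rw [← sub_eq_zero, h1]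
    refine hj.eq_zero _ (sub_mem h2.1 hx) (hφ0 _ ?_)
    rw [map_sub, sub_eq_zero]
    exact h2.2
  -- Needed because `φ` may send a generator to an element of `V'` plus a term `φ s` from stage `j`.
  -- Moving `φ s` past `v` and `s` past `b v` costs the same sign, all degrees being `j + 1`.
  have hgmul : ∀ s ∈ m.stageIn n j, s ∈ A.gr (j + 1) →
      ∀ y ∈ (m'.stage (j + 1)).toSubalgebra, g (y * φ s) = g y * s := by
    intro s hs hsg y hy
    have hφs : φ s ∈ (m'.stage (j + 1)).toSubalgebra := hsucc' (hj.mapsTo s hs)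
    let Q : Submodule ℚ m' := Subalgebra.toSubmodule (m'.stage (j + 1)).toSubalgebra ⊓
      LinearMap.eqLocus (g ∘ₗ LinearMap.mulRight ℚ (φ s)) (LinearMap.mulRight ℚ s ∘ₗ g)
    have hQ : LinearMap.range (hirschMap (m'.stage j) (j + 1) V' hV'.le_gr) ≤ Q := by
      refine range_hirschMap_le _ _ _ _ _ ?_ ?_
      · intro r hr
        refine ⟨hsucc' hr, ?_⟩
        obtain ⟨x, hx, hxr⟩ := hj.surj ⟨r, hle' hr⟩ hr
        have hxr' : φ x = r := congrArg Subtype.val hxr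
        change g (r * φ s) = g r * s
        rw [← hxr', ← map_mul, hgφ _ (mul_mem hx hs), hgφ _ hx]
      · rintro r ⟨hr, hrs⟩ v hv
        have hrs' : g (r * φ s) = g r * s := hrs
        refine ⟨mul_mem (S := Subalgebra ℚ m') hr (gr_le_stage m' le_rfl (hV'.le_gr hv)), ?_⟩
        change g (r * v * φ s) = g (r * v) * s
        have hc : v * φ s = (-1 : ℚ) ^ ((j + 1) * (j + 1)) • (φ s * v) :=
          m'.graded_comm (hV'.le_gr hv) (f.map_gr hsg)
        have hc' : b ⟨v, hv⟩ * s = (-1 : ℚ) ^ ((j + 1) * (j + 1)) • (s * b ⟨v, hv⟩) :=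
          A.graded_comm (hb _).1 hsg
        have h1 : g (r * φ s * v) = g (r * φ s) * b ⟨v, hv⟩ :=
          hgb _ (mul_mem (S := Subalgebra ℚ m') hr hφs) ⟨v, hv⟩
        have h2 : g (r * v) = g r * b ⟨v, hv⟩ := hgb _ hr ⟨v, hv⟩
        rw [mul_assoc, hc, mul_smul_comm, ← mul_assoc, map_smul, h1, hrs', h2, mul_assoc, mul_assoc,
          hc', mul_smul_comm]
    rw [hV'.range_eq] at hQ
    exact (hQ hy).2
  have hleft : ∀ x ∈ m.stageIn n (j + 1),
      φ x ∈ (m'.stage (j + 1)).toSubalgebra ∧ g (φ x) = x := by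
    intro x hx
    let Q : Submodule ℚ A := Submodule.comap φ.toLinearMap
        (Subalgebra.toSubmodule (m'.stage (j + 1)).toSubalgebra) ⊓
      LinearMap.eqLocus (g ∘ₗ φ.toLinearMap) LinearMap.id
    suffices hQ : x ∈ Q from hQ
    refine hV.mem_of_mem_stageIn_succ hjn Q ?_ ?_ hx
    · exact fun x hx => ⟨hsucc' (hj.mapsTo x hx), hgφ x hx⟩
    · rintro x ⟨hx, hxg⟩ v hv
      have hxg' : g (φ x) = x := hxg
      have hvg : v ∈ A.gr (j + 1) := hV.le_gr hv
      have hφv : φ v ∈ m'.gr (j + 1) := f.map_gr hvg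
      constructor
      · change φ (x * v) ∈ (m'.stage (j + 1)).toSubalgebra
        rw [map_mul]
        exact mul_mem (S := Subalgebra ℚ m') hx (gr_le_stage m' le_rfl hφv)
      · obtain ⟨s', hs', v', hv', hsv⟩ := Submodule.mem_sup.1 (hV'.gr_le hφv)
        have hb1 : φ (b ⟨v', hv'⟩) = v' := (hb ⟨v', hv'⟩).2
        have hs'g : s' ∈ m'.gr (j + 1) := by
          rw [← add_sub_cancel_right s' v', hsv]
          exact sub_mem hφv (hV'.le_gr hv')
        obtain ⟨s, hs, hsg, hss⟩ := hj.exists_mem_gr (y := ⟨s', hle' hs'⟩) hs' hs'g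
        have hss' : φ s = s' := congrArg Subtype.val hss
        -- Both sides have degree `j + 1` and the same image under `φ`, so injectivity in that
        -- degree identifies them.
        have hv2 : v = s + b ⟨v', hv'⟩ := by
          rw [← sub_eq_zero]
          refine hj.eq_zero_of_mem_gr hV hf.1
            (sub_mem hvg (add_mem hsg (hb _).1)) (hφ0 _ ?_)
          rw [map_sub, map_add, hb1, hss', hsv, sub_self]
        change g (φ (x * v)) = x * v
        have h1 : g (φ x * v') = g (φ x) * b ⟨v', hv'⟩ := hgb _ hx ⟨v', hv'⟩
        have h2 : g (φ x * φ s) = g (φ x) * s := hgmul s hs hsg _ hx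
        rw [map_mul, hv2, map_add, hb1, mul_add, map_add, h2, h1, hxg', mul_add]
  refine ⟨fun x hx => (hleft x hx).1, fun x hx h => ?_, fun y hy => ?_⟩
  · rw [← (hleft x hx).2, show φ x = 0 from congrArg Subtype.val h, map_zero]
  · refine hV'.mem_of_mem_stageIn_succ hjn
      (Submodule.map f.toAlgHom.toLinearMap (Subalgebra.toSubmodule (m.stageIn n (j + 1)))) ?_ ?_ hy
    · intro y hy
      obtain ⟨x, hx, hxy⟩ := hj.surj y hy
      exact ⟨x, stageIn_mono m n (Nat.le_succ j) hx, hxy⟩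
    · rintro _ ⟨x, hx, rfl⟩ v hv
      refine ⟨x * b ⟨_, hv⟩, mul_mem (S := Subalgebra ℚ A) hx
        (mem_stageIn_of_mem_gr le_rfl (hb ⟨_, hv⟩).1), ?_⟩
      change f.toAlgHom (x * b ⟨_, hv⟩) = f.toAlgHom x * v
      have hfb : f.toAlgHom (b ⟨_, hv⟩) = v := (m'.stage n).incl_injective (hb ⟨_, hv⟩).2
      rw [map_mul, hfb]

/-- Both stages consist of scalars, which `f` fixes; nontriviality of `m'` keeps them from
collapsing. -/
theorem Hom.bijectiveOnStage_zero [Nontrivial m'] (h0 : (m.stage 0).toSubalgebra = ⊥)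
    (h0' : (m'.stage 0).toSubalgebra = ⊥) : f.BijectiveOnStage 0 := by
  have hscal : ∀ x ∈ m.stageIn n 0, ∃ q : ℚ, algebraMap ℚ (m.stage n).toCDGA q = x := by
    intro x hx
    have hx' : (m.stage n).incl.toAlgHom x ∈ (m.stage 0).toSubalgebra := hx
    rw [h0] at hx'
    obtain ⟨q, hq⟩ := Algebra.mem_bot.1 hx'
    exact ⟨q, (m.stage n).incl_injective (((m.stage n).incl.toAlgHom.commutes q).trans hq)⟩
  refine ⟨fun x hx => ?_, fun x hx h => ?_, fun y hy => ?_⟩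
  · obtain ⟨q, rfl⟩ := hscal x hx
    rw [AlgHom.commutes]
    exact (m'.stageIn n 0).algebraMap_mem q
  · obtain ⟨q, rfl⟩ := hscal x hx
    rw [AlgHom.commutes] at h
    have h2 : algebraMap ℚ m' q = 0 := congrArg Subtype.val h
    rw [(map_eq_zero_iff _ (algebraMap ℚ m').injective).1 h2, map_zero]
  · have hy' : (m'.stage n).incl.toAlgHom y ∈ (m'.stage 0).toSubalgebra := hy
    rw [h0'] at hy'
    obtain ⟨q, hq⟩ := Algebra.mem_bot.1 hy'
    exact ⟨algebraMap ℚ _ q, (m.stageIn n 0).algebraMap_mem q, (f.toAlgHom.commutes q).trans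
      ((m'.stage n).incl_injective (((m'.stage n).incl.toAlgHom.commutes q).trans hq))⟩

end Step

end CDGA

/-! ### Induction over the stages. -/

theorem mainTheorem7 (m : CDGA.{u}) (m' : CDGA.{v}) (hm : m.IsMinimal) (hm' : m'.IsMinimal)
    (k : ℕ) (hk : CDGA.Isomorphic (m.stage k).toCDGA (m'.stage k).toCDGA)
    (hf : ∃ f : CDGA.Hom (m.stage (k + 1)).toCDGA (m'.stage (k + 1)).toCDGA,
      f.IsNIsomorphism (k + 1)) :
    CDGA.Isomorphic (m.stage (k + 1)).toCDGA (m'.stage (k + 1)).toCDGA := by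
  obtain ⟨f, hf1, hf2⟩ := hf
  obtain ⟨h0, hV⟩ := hm.stage_zero_and_exists_isGenerators
  obtain ⟨h0', hV'⟩ := hm'.stage_zero_and_exists_isGenerators
  have hnt : Nontrivial m' := hm'.1
  have key : ∀ j ≤ k + 1, f.BijectiveOnStage j := by
    intro j
    induction j with
    | zero => exact fun _ => CDGA.Hom.bijectiveOnStage_zero h0 h0'
    | succ j ih =>
      intro hj
      obtain ⟨V, hV⟩ := hV j
      obtain ⟨V', hV'⟩ := hV' j
      refine (ih (by omega)).succ hj hV hV' (hf1 _ hj) ?_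
      -- Injectivity on `H^(j+2)` comes from the isomorphism range when `j < k`; for `j = k` it is
      -- exactly the monomorphism condition on `H^(k+2)`.
      rcases hj.lt_or_eq with h | h
      · exact (hf1 (j + 2) h).1
      · obtain rfl : j = k := by omega
        exact hf2
  have hj := key (k + 1) le_rfl
  refine CDGA.isomorphic_of_bijective f ⟨?_, fun y => ?_⟩
  · rw [injective_iff_map_eq_zero]
    exact fun x hx => hj.eq_zero x (Subtype.prop x) hx
  · obtain ⟨x, -, hx⟩ := hj.surj y (Subtype.prop y)
    exact ⟨x, hx⟩
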